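/- Let $k$ be a perfect field of characteristic $p>0$, let $n\ge 0$, and let $\boldsymbol t=(t_1,\dots,t_n)$ and $y$ be indeterminates. For $\boldsymbol r\in\{0,\dots,p-1\}^n$ the section operator $S_{\boldsymbol r}\colon k[\![\boldsymbol t]\!]\to k[\![\boldsymbol t]\!]$ is defined by $$S_{\boldsymbol r}\Big(\sum_{\boldsymbol i\in\mathbb N^n}a(\boldsymbol i)\,\boldsymbol t^{\boldsymbol i}\Big)=\sum_{\boldsymbol i\in\mathbb N^n}a(p\boldsymbol i+\boldsymbol r)^{1/p}\,\boldsymbol t^{\boldsymbol i},$$ and $\Omega_n$ denotes the monoid generated by all the section operators under composition. For a polynomial $A=\sum_{\boldsymbol i\in\mathbb N^n,\,j\in\mathbb N}a_{\boldsymbol i,j}\,\boldsymbol t^{\boldsymbol i}y^j\in k[\boldsymbol t,y]$, the Newton polytope $\mathrm{NP}(A)$ is the convex hull in $\mathbb R^{n+1}$ of the points $(\boldsymbol i,j)$ with $a_{\boldsymbol i,j}\neq 0$. Let $A\in k[\boldsymbol t,y]$ be a nonzero polynomial and let $f\in k[\![\boldsymbol t]\!]$ satisfy $A(\boldsymbol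 t,f)=0$. Set $C=\mathrm{NP}(A)+(-1,0]^{n+1}$ (Minkowski sum). Then $C\cap\mathbb N^{n+1}$ is finite, and there exists a $k$-vector subspace $W\subset k[\![\boldsymbol t]\!]$ of dimension at most $\mathrm{Card}(C\cap\mathbb N^{n+1})$ which contains $f$ and is invariant under the action of $\Omega_n$, that is, $\omega(g)\in W$ for all $\omega\in\Omega_n$ and all $g\in W$. -/

import Mathlib

open scoped Pointwise

noncomputable section

namespace SectionChristol

/-- The section operator `S_r` on `k⟦t₁, …, tₙ⟧`, for `r ∈ {0, …, p - 1}ⁿ`: it sends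
`∑ a(i) t^i` to `∑ a(p i + r)^{1/p} t^i`, the `p`-th root being the inverse of the Frobenius
automorphism of the perfect ring `k`. -/
def sectionOp (k : Type*) [Field k] (p : ℕ) [Fact p.Prime] [CharP k p] [PerfectRing k p]
    {n : ℕ} (r : Fin n → Fin p) (f : MvPowerSeries (Fin n) k) : MvPowerSeries (Fin n) k :=
  fun i : Fin n →₀ ℕ => (frobeniusEquiv k p).symm
    (MvPowerSeries.coeff (p • i + Finsupp.equivFunOnFinite.symm (fun j => (r j : ℕ))) f)

/-- The monoid, under composition, generated by all section operators on `k⟦t₁, …, tₙ⟧`. -/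
def sectionMonoid (k : Type*) [Field k] (p : ℕ) [Fact p.Prime] [CharP k p] [PerfectRing k p]
    (n : ℕ) : Submonoid (Function.End (MvPowerSeries (Fin n) k)) :=
  Submonoid.closure (Set.range fun r : Fin n → Fin p => sectionOp k p r)

/-- The inclusion of `ℕ^m` into `ℝ^m`. -/
def natVec {m : ℕ} (v : Fin m → ℕ) : Fin m → ℝ := fun i => (v i : ℝ)

/-- The Newton polytope of a polynomial in `m` variables: the convex hull in `ℝ^m` of the exponents
of its monomials with nonzero coefficient. -/
def newtonPolytope {k : Type*} [Field k] {m : ℕ} (A : MvPolynomial (Fin m) k) :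
    Set (Fin m → ℝ) :=
  convexHull ℝ {x | ∃ e : Fin m →₀ ℕ, A.coeff e ≠ 0 ∧ natVec e = x}

/-- `NP(A) + (-1, 0]^m` (Minkowski sum). -/
def thickenedPolytope {k : Type*} [Field k] {m : ℕ} (A : MvPolynomial (Fin m) k) :
    Set (Fin m → ℝ) :=
  newtonPolytope A + Set.univ.pi fun _ => Set.Ioc (-1 : ℝ) 0

/-- The value `A(t₁, …, tₙ, f)` of a polynomial `A ∈ k[t₁, …, tₙ, y]` at a power series
`f ∈ k⟦t₁, …, tₙ⟧`; the last of the `n + 1` variables is `y`. -/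
def evalAt {k : Type*} [Field k] {n : ℕ} (A : MvPolynomial (Fin (n + 1)) k)
    (f : MvPowerSeries (Fin n) k) : MvPowerSeries (Fin n) k :=
  MvPolynomial.aeval
    (Fin.snoc (α := fun _ => MvPowerSeries (Fin n) k) (fun i => MvPowerSeries.X i) f) A

end SectionChristol

end

/-! Write `A = (y - f)^m H` with `h = H(f) ≠ 0`. The space `W` consists of the residues `g` at `y =
f` of the forms `P/A dy` with at most a simple pole there and `P` supported in `C`. As a congruence
this reads `P ≡ (y - f)^(m-1) g h` modulo `(y - f)^m`, which needs no fractions and allows `m > 1`.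
The class of `P` determines `g`, so `dim W` is at most the number of lattice points of `C`
(`finite_and_finrank_residueSpace_le`).

Invariance: `P/A = P A^(p-1) / A^p`, and sections pull out `p`-th powers. Hence the section with
index `p - 1` in `y`, applied to `P A^(p-1)`, gives a numerator over `A` with residue `S_r g`
(`dvd_polySection_sub`). Its support is again in `C`: exponents are shifted down by at most `p - 1`,
then divided by `p` (`polySection_mul_pow_mem_supportedIn`).

Membership of `f` (`exists_supportedIn_dvd_sub`): if `p ∤ m`, take `P = m⁻¹ y ∂A/∂y`. If `p ∣ m`,
decompose `A = ∑ t^r y^s B_{r,s}^p` and induct on `m` through the `B_{r,s}`. -/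

namespace SectionChristol

open Polynomial

/-! ### Sections in the variable `y`. -/

section PolySection

variable {R : Type*} [CommRing R]

/-- The section operator in `y` on `R[y]`, twisted by an additive map `σ` on the coefficients:
it sends `∑ aⱼ yʲ` to `∑ σ(a_{pj+s}) yʲ`. -/
noncomputable def polySection (p : ℕ) (σ : R →+ R) (s : ℕ) (G : R[X]) : R[X] :=
  ∑ i ∈ Finset.range (G.natDegree + 1), monomial i (σ (G.coeff (p * i + s)))

theorem coeff_polySection {p : ℕ} (hp : 0 < p) (σ : R →+ R) (s : ℕ) (G : R[X]) (i : ℕ) :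
    (polySection p σ s G).coeff i = σ (G.coeff (p * i + s)) := by
  simp only [polySection, finsetSum_coeff, coeff_monomial, Finset.sum_ite_eq', Finset.mem_range]
  split_ifs with h
  · rfl
  · rw [coeff_eq_zero_of_natDegree_lt, map_zero]
    have : i ≤ p * i := Nat.le_mul_of_pos_left i hp
    omega

theorem polySection_add {p : ℕ} (hp : 0 < p) (σ : R →+ R) (s : ℕ) (G H : R[X]) :
    polySection p σ s (G + H) = polySection p σ s G + polySection p σ s H := by
  ext i
  simp [coeff_polySection hp]

/-- Frobenius is additive, so `G` may be a monomial `c y^j`; then `s < p` gives `p j ≤ p i + s`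
exactly when `j ≤ i`. -/
theorem polySection_pow_mul {p : ℕ} [Fact p.Prime] [CharP R p] (σ : R →+ R)
    (hσ : ∀ a b, σ (a ^ p * b) = a * σ b) {s : ℕ} (hs : s < p) (G H : R[X]) :
    polySection p σ s (G ^ p * H) = G * polySection p σ s H := by
  have hp : 0 < p := (Fact.out : p.Prime).pos
  induction G using Polynomial.induction_on' with
  | add G₁ G₂ h₁ h₂ => rw [add_pow_char, add_mul, polySection_add hp, h₁, h₂, add_mul]
  | monomial j c =>
    ext i
    rw [← C_mul_X_pow_eq_monomial, mul_pow, ← C_pow, ← pow_mul, mul_assoc, mul_assoc,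
      coeff_polySection hp, coeff_C_mul, coeff_C_mul, coeff_X_pow_mul', coeff_X_pow_mul', hσ]
    congr 1
    by_cases hji : j ≤ i
    · have h1 : j * p ≤ p * i := by rw [mul_comm]; exact Nat.mul_le_mul_left p hji
      rw [if_pos (h1.trans (Nat.le_add_right _ _)), if_pos hji, coeff_polySection hp,
        Nat.mul_sub, mul_comm j p]
      congr 2
      rw [mul_comm j p] at h1
      omega
    · have h1 : p * (i + 1) ≤ p * j := Nat.mul_le_mul_left p (by omega)
      rw [mul_add, mul_one, mul_comm p j] at h1
      rw [if_neg hji, if_neg (by omega), map_zero]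

theorem sum_C_mul_X_pow_mul_polySection_pow {ι : Type*} [Fintype ι] {p : ℕ} [Fact p.Prime]
    [CharP R p] (σ : ι → R →+ R) (t : ι → R) (hσ : ∀ a, ∑ r, t r * σ r a ^ p = a) (G : R[X]) :
    ∑ r, ∑ s ∈ Finset.range p, C (t r) * X ^ s * polySection p (σ r) s G ^ p = G := by
  have hp : 0 < p := (Fact.out : p.Prime).pos
  ext j
  simp only [finsetSum_coeff]
  conv_rhs => rw [← hσ (G.coeff j)]
  refine Finset.sum_congr rfl fun r _ => ?_
  have key : ∀ s, (C (t r) * X ^ s * polySection p (σ r) s G ^ p).coeff j =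
      if s ≤ j then (if p ∣ j - s then t r * σ r (G.coeff (p * ((j - s) / p) + s)) ^ p else 0)
        else 0 := by
    intro s
    rw [mul_assoc, coeff_C_mul, coeff_X_pow_mul', ← map_frobenius_expand p, coeff_map,
      coeff_expand hp, coeff_polySection hp]
    split_ifs <;> simp [frobenius_def, hp.ne']
  simp only [key]
  rw [Finset.sum_eq_single (j % p)]
  · have h := Nat.mod_add_div j p
    have h2 : j - j % p = p * (j / p) := by omega
    rw [if_pos (Nat.mod_le _ _), h2, if_pos (dvd_mul_right _ _), Nat.mul_div_cancel_left _ hp,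
      Nat.div_add_mod]
  · intro s hs hne
    split_ifs with h1 h2
    · refine absurd ?_ hne
      rw [← Nat.mod_eq_of_lt (Finset.mem_range.1 hs)]
      exact (Nat.modEq_iff_dvd' h1).2 h2
    · rfl
    · rfl
  · intro h
    exact absurd (Finset.mem_range.2 (Nat.mod_lt _ hp)) h

/-- Only the leading coefficient has index congruent to `p - 1`. This is the compatibility of
sections with the residue of `g dy / (y - f)`. -/
theorem polySection_X_sub_C_pow_mul_C {p : ℕ} [Fact p.Prime] (σ : R →+ R) (f g : R) :
    polySection p σ (p - 1) ((X - C f) ^ (p - 1) * C g) = C (σ g) := by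
  have hp : 0 < p := (Fact.out : p.Prime).pos
  nontriviality R
  have hm : ((X - C f) ^ (p - 1)).Monic := (monic_X_sub_C f).pow _
  have hd : ((X - C f) ^ (p - 1)).natDegree = p - 1 := by
    rw [(monic_X_sub_C f).natDegree_pow, natDegree_X_sub_C, mul_one]
  ext i
  rw [coeff_polySection hp, coeff_mul_C, coeff_C]
  split_ifs with hi
  · subst hi
    have := hm.coeff_natDegree
    rw [hd] at this
    rw [mul_zero, zero_add, this, one_mul]
  · rw [coeff_eq_zero_of_natDegree_lt, zero_mul, map_zero]
    rw [hd]
    have : 0 < p * i := Nat.mul_pos hp (Nat.pos_of_ne_zero hi)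
    omega

end PolySection

/-! ### Sections of power series in `t`. -/

section PowerSeries

variable {k : Type*} [Field k] {p n : ℕ}

/-- The residue vector `r ∈ {0, …, p - 1}ⁿ` as an exponent. -/
noncomputable def residueExponent (r : Fin n → Fin p) : Fin n →₀ ℕ :=
  Finsupp.equivFunOnFinite.symm fun j => (r j : ℕ)

@[simp]
theorem residueExponent_apply (r : Fin n → Fin p) (j : Fin n) :
    residueExponent r j = (r j : ℕ) := rfl

variable [Fact p.Prime] [CharP k p]

instance : CharP (MvPowerSeries (Fin n) k) p :=
  charP_of_injective_algebraMap (algebraMap k (MvPowerSeries (Fin n) k)).injective p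

theorem coeff_pow_char_smul (a : MvPowerSeries (Fin n) k) (d : Fin n →₀ ℕ) :
    MvPowerSeries.coeff (p • d) (a ^ p) = MvPowerSeries.coeff d a ^ p := by
  have hp : p ≠ 0 := (Fact.out : p.Prime).ne_zero
  rw [← MvPowerSeries.map_frobenius_expand p hp, MvPowerSeries.coeff_map,
    MvPowerSeries.coeff_expand_smul, frobenius_def]

theorem exists_eq_smul_of_coeff_pow_char_ne_zero (a : MvPowerSeries (Fin n) k) (d : Fin n →₀ ℕ)
    (h : MvPowerSeries.coeff d (a ^ p) ≠ 0) : ∃ e : Fin n →₀ ℕ, d = p • e := by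
  have hp : p ≠ 0 := (Fact.out : p.Prime).ne_zero
  have hdvd : ∀ i, p ∣ d i := by
    intro i
    by_contra hi
    rw [← MvPowerSeries.map_frobenius_expand p hp, MvPowerSeries.coeff_map,
      MvPowerSeries.coeff_expand_of_not_dvd p hp a hi, map_zero] at h
    exact h rfl
  exact ⟨d.mapRange (· / p) (Nat.zero_div p),
    Finsupp.ext fun i => by simp [Nat.mul_div_cancel' (hdvd i)]⟩

variable [PerfectRing k p]

theorem coeff_sectionOp (r : Fin n → Fin p) (f : MvPowerSeries (Fin n) k) (i : Fin n →₀ ℕ) :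
    MvPowerSeries.coeff i (sectionOp k p r f) =
      (frobeniusEquiv k p).symm (MvPowerSeries.coeff (p • i + residueExponent r) f) := rfl

/-- The section operator as an additive map. -/
noncomputable def sectionHom (r : Fin n → Fin p) :
    MvPowerSeries (Fin n) k →+ MvPowerSeries (Fin n) k where
  toFun := sectionOp k p r
  map_zero' := by
    ext i
    simp [coeff_sectionOp]
  map_add' f g := by
    ext i
    simp [coeff_sectionOp]

theorem coeff_sectionHom (r : Fin n → Fin p) (f : MvPowerSeries (Fin n) k) (i : Fin n →₀ ℕ) :
    MvPowerSeries.coeff i (sectionHom r f) =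
      (frobeniusEquiv k p).symm (MvPowerSeries.coeff (p • i + residueExponent r) f) := rfl

theorem sectionHom_pow_mul (r : Fin n → Fin p) (a b : MvPowerSeries (Fin n) k) :
    sectionHom r (a ^ p * b) = a * sectionHom r b := by
  classical
  have hp : 0 < p := (Fact.out : p.Prime).pos
  ext i
  rw [coeff_sectionHom, MvPowerSeries.coeff_mul, MvPowerSeries.coeff_mul, map_sum]
  symm
  -- Pairs outside the image contribute zero, since `a ^ p` only has exponents divisible by `p`.
  refine Finset.sum_of_injOn (fun x => (p • x.1, p • x.2 + residueExponent r)) ?_ ?_ ?_ ?_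
  · rintro ⟨u, v⟩ - ⟨u', v'⟩ - h
    simp only [Prod.mk.injEq, add_left_inj] at h
    rw [nsmul_right_inj hp.ne', nsmul_right_inj hp.ne'] at h
    exact Prod.ext h.1 h.2
  · rintro ⟨u, v⟩ h
    simp only [Finset.mem_coe, Finset.HasAntidiagonal.mem_antidiagonal] at h ⊢
    rw [← add_assoc, ← smul_add, h]
  · rintro ⟨u, v⟩ h hn
    rw [Finset.HasAntidiagonal.mem_antidiagonal] at h
    by_contra hne
    have hu : MvPowerSeries.coeff u (a ^ p) ≠ 0 := by
      intro h0
      simp [h0] at hne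
    obtain ⟨e, rfl⟩ := exists_eq_smul_of_coeff_pow_char_ne_zero a u hu
    have hei : e ≤ i := by
      intro j
      have hj := DFunLike.congr_fun h j
      simp only [Finsupp.add_apply, Finsupp.smul_apply, smul_eq_mul, residueExponent_apply] at hj
      have hr := (r j).isLt
      by_contra hlt
      have : p * (i j + 1) ≤ p * e j := Nat.mul_le_mul_left p (by omega)
      rw [mul_add] at this
      omega
    refine hn ⟨(e, i - e), ?_, ?_⟩
    · simp [add_tsub_cancel_of_le hei]
    · refine Prod.ext rfl ?_
      have h' : p • e + (p • (i - e) + residueExponent r) = p • e + v := by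
        rw [h, ← add_assoc, ← smul_add, add_tsub_cancel_of_le hei]
      exact add_left_cancel h'
  · rintro ⟨u, v⟩ -
    rw [map_mul, coeff_pow_char_smul, coeff_sectionHom]
    congr 1
    exact ((frobeniusEquiv k p).symm_apply_apply _).symm

theorem sum_monomial_mul_sectionHom_pow (a : MvPowerSeries (Fin n) k) :
    ∑ r : Fin n → Fin p, MvPowerSeries.monomial (residueExponent r) 1 * sectionHom r a ^ p = a := by
  classical
  have hp : 0 < p := (Fact.out : p.Prime).pos
  ext d
  rw [map_sum]
  let r₀ : Fin n → Fin p := fun j => ⟨d j % p, Nat.mod_lt _ hp⟩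
  have hd : p • d.mapRange (· / p) (Nat.zero_div p) + residueExponent r₀ = d :=
    Finsupp.ext fun j => by simp [r₀, Nat.div_add_mod]
  rw [Finset.sum_eq_single r₀]
  · rw [MvPowerSeries.coeff_monomial_mul]
    have hle : residueExponent r₀ ≤ d := by
      rw [← hd]
      exact le_add_self
    rw [if_pos hle, one_mul, ← eq_tsub_of_add_eq hd, coeff_pow_char_smul, coeff_sectionHom, hd]
    exact (frobeniusEquiv k p).apply_symm_apply _
  · intro r _ hr
    rw [MvPowerSeries.coeff_monomial_mul]
    split_ifs with hle
    · rw [one_mul]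
      by_contra hne
      obtain ⟨e, he⟩ := exists_eq_smul_of_coeff_pow_char_ne_zero _ _ hne
      refine hr (funext fun j => Fin.ext ?_)
      have hj : d j = p * e j + r j := by
        conv_lhs => rw [← tsub_add_cancel_of_le hle, he]
        simp
      simp [r₀, hj, Nat.mod_eq_of_lt (r j).isLt]
    · rfl
  · simp

end PowerSeries

/-! ### Supports, Newton polytopes and lattice point counts. -/

section Support

variable {k : Type*} [Field k] {n : ℕ}

/-- The exponent `(d, j) ∈ ℕⁿ⁺¹` of the monomial `t^d y^j`, as a real vector. -/
def exponentVec (d : Fin n →₀ ℕ) (j : ℕ) : Fin (n + 1) → ℝ :=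
  natVec (Fin.snoc (α := fun _ => ℕ) d j)

@[simp]
theorem exponentVec_castSucc (d : Fin n →₀ ℕ) (j : ℕ) (i : Fin n) :
    exponentVec d j i.castSucc = d i := by
  simp [exponentVec, natVec]

@[simp]
theorem exponentVec_last (d : Fin n →₀ ℕ) (j : ℕ) : exponentVec d j (Fin.last n) = j := by
  simp [exponentVec, natVec]

theorem exponentVec_add (d d' : Fin n →₀ ℕ) (j j' : ℕ) :
    exponentVec (d + d') (j + j') = exponentVec d j + exponentVec d' j' := by
  ext i
  refine Fin.lastCases ?_ (fun i => ?_) i <;> simp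

theorem exponentVec_smul (p : ℕ) (d : Fin n →₀ ℕ) (j : ℕ) :
    exponentVec (p • d) (p * j) = (p : ℝ) • exponentVec d j := by
  ext i
  refine Fin.lastCases ?_ (fun i => ?_) i <;> simp

variable (k) in
/-- The elements of `k⟦t⟧[y]` all of whose exponents lie in `K`. -/
def supportedIn (K : Set (Fin (n + 1) → ℝ)) : Submodule k (MvPowerSeries (Fin n) k)[X] where
  carrier := {G | ∀ d j, MvPowerSeries.coeff d (G.coeff j) ≠ 0 → exponentVec d j ∈ K}
  zero_mem' := by simp
  add_mem' {G H} hG hH d j h := by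
    by_cases hg : MvPowerSeries.coeff d (G.coeff j) = 0
    · exact hH d j fun h0 => h (by simp [hg, h0])
    · exact hG d j hg
  smul_mem' c G hG d j h := hG d j fun h0 => h (by
    rw [Polynomial.coeff_smul, MvPowerSeries.coeff_smul, h0, mul_zero])

theorem supportedIn_mono {K L : Set (Fin (n + 1) → ℝ)} (h : K ⊆ L) :
    supportedIn k K ≤ supportedIn k L :=
  fun _ hG d j hne => h (hG d j hne)

theorem mul_mem_supportedIn {K L : Set (Fin (n + 1) → ℝ)} {G H : (MvPowerSeries (Fin n) k)[X]}
    (hG : G ∈ supportedIn k K) (hH : H ∈ supportedIn k L) : G * H ∈ supportedIn k (K + L) := by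
  classical
  intro d j hne
  rw [Polynomial.coeff_mul, map_sum] at hne
  obtain ⟨⟨a, b⟩, hab, hne⟩ := Finset.exists_ne_zero_of_sum_ne_zero hne
  rw [MvPowerSeries.coeff_mul] at hne
  obtain ⟨⟨u, v⟩, huv, hne⟩ := Finset.exists_ne_zero_of_sum_ne_zero hne
  rw [Finset.HasAntidiagonal.mem_antidiagonal] at hab huv
  obtain ⟨h₁, h₂⟩ := ne_zero_and_ne_zero_of_mul hne
  rw [← hab, ← huv, exponentVec_add]
  exact Set.add_mem_add (hG u a h₁) (hH v b h₂)

/-- Convexity enters through `j K + K = (j + 1) K`. -/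
theorem mul_pow_mem_supportedIn {K B : Set (Fin (n + 1) → ℝ)} (hK : Convex ℝ K)
    {P G : (MvPowerSeries (Fin n) k)[X]} (hP : P ∈ supportedIn k (K + B))
    (hG : G ∈ supportedIn k K) (j : ℕ) :
    P * G ^ j ∈ supportedIn k (((j + 1 : ℕ) : ℝ) • K + B) := by
  induction j with
  | zero => simpa using hP
  | succ j ih =>
    rw [pow_succ, ← mul_assoc]
    refine supportedIn_mono ?_ (mul_mem_supportedIn ih hG)
    rw [Nat.cast_add (j + 1), Nat.cast_one, hK.add_smul (by positivity) zero_le_one, one_smul,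
      add_right_comm]

theorem C_monomial_mul_X_pow_mem_supportedIn (d : Fin n →₀ ℕ) (j : ℕ) (c : k) :
    (C (MvPowerSeries.monomial d c) * X ^ j : (MvPowerSeries (Fin n) k)[X]) ∈
      supportedIn k {exponentVec d j} := by
  classical
  intro d' j' h
  rw [coeff_C_mul, coeff_X_pow, mul_ite, mul_one, mul_zero] at h
  split_ifs at h with hj
  · rw [MvPowerSeries.coeff_monomial] at h
    split_ifs at h with hd
    · rw [hj, hd]
      rfl
    · exact absurd rfl h
  · simp at h

theorem X_mul_derivative_mem_supportedIn {K : Set (Fin (n + 1) → ℝ)}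
    {G : (MvPowerSeries (Fin n) k)[X]} (hG : G ∈ supportedIn k K) :
    X * derivative G ∈ supportedIn k K := by
  intro d j h
  cases j with
  | zero => simp at h
  | succ j =>
    refine hG d (j + 1) fun h0 => h ?_
    rw [coeff_X_mul, coeff_derivative, ← Nat.cast_succ, mul_comm, ← nsmul_eq_mul, map_nsmul, h0,
      smul_zero]

theorem polySection_mem_supportedIn {p : ℕ} [Fact p.Prime] [CharP k p] [PerfectRing k p]
    {K : Set (Fin (n + 1) → ℝ)} {G : (MvPowerSeries (Fin n) k)[X]} (hG : G ∈ supportedIn k K)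
    (r : Fin n → Fin p) (s : ℕ) :
    polySection p (sectionHom r) s G ∈
      supportedIn k {x | (p : ℝ) • x + exponentVec (residueExponent r) s ∈ K} := by
  have hp : 0 < p := (Fact.out : p.Prime).pos
  intro d j h
  rw [coeff_polySection hp, coeff_sectionHom] at h
  rw [Set.mem_ofPred_eq, ← exponentVec_smul, ← exponentVec_add]
  exact hG _ _ fun h0 => h (by rw [h0, map_zero])

theorem finite_and_finrank_supportedIn_le {K : Set (Fin (n + 1) → ℝ)}
    (hK : (K ∩ Set.range natVec).Finite) :
    Module.Finite k (supportedIn k K) ∧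
      Module.finrank k (supportedIn k K) ≤ (K ∩ Set.range natVec).ncard := by
  classical
  have := hK.fintype
  choose v hv using fun x : ↥(K ∩ Set.range natVec) => x.2.2
  let Φ : supportedIn k K →ₗ[k] (↥(K ∩ Set.range natVec) → k) :=
    LinearMap.pi fun x =>
      (MvPowerSeries.coeff (Finsupp.equivFunOnFinite.symm (Fin.init (v x)))) ∘ₗ
        ((lcoeff (MvPowerSeries (Fin n) k) (v x (Fin.last n))).restrictScalars k) ∘ₗ
          (supportedIn k K).subtype
  have hΦ : Function.Injective Φ := by
    rw [injective_iff_map_eq_zero]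
    rintro ⟨G, hG⟩ h0
    refine Subtype.ext (Polynomial.ext fun j => MvPowerSeries.ext fun d => ?_)
    by_contra hne
    have hne' : MvPowerSeries.coeff d (G.coeff j) ≠ 0 := by simpa using hne
    let x : ↥(K ∩ Set.range natVec) := ⟨exponentVec d j, hG d j hne', _, rfl⟩
    have hx : v x = Fin.snoc (α := fun _ => ℕ) d j := by
      have h1 : natVec (v x) = exponentVec d j := hv x
      funext i
      have h2 := congrFun h1 i
      simpa [exponentVec, natVec] using h2
    have h3 := congrFun h0 x
    have h4 : Finsupp.equivFunOnFinite.symm (Fin.init (v x)) = d := by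
      ext i
      simp [hx]
    have h5 : v x (Fin.last n) = j := by simp [hx]
    apply hne'
    rw [← h4, ← h5]
    exact h3
  refine ⟨Module.Finite.of_injective Φ hΦ, ?_⟩
  have h := LinearMap.finrank_le_finrank_of_injective hΦ
  rwa [Module.finrank_fintype_fun_eq_card, ← Nat.card_eq_fintype_card,
    Nat.card_coe_set_eq] at h

/-- A polynomial in `k[t, y]`, seen in `k⟦t⟧[y]`. -/
noncomputable def toPolynomial :
    MvPolynomial (Fin (n + 1)) k →ₐ[k] (MvPowerSeries (Fin n) k)[X] :=
  MvPolynomial.aeval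
    (Fin.snoc (α := fun _ => (MvPowerSeries (Fin n) k)[X]) (fun i => C (MvPowerSeries.X i)) X)

theorem eval_toPolynomial (A : MvPolynomial (Fin (n + 1)) k) (f : MvPowerSeries (Fin n) k) :
    (toPolynomial A).eval f = evalAt A f := by
  have h : ((aeval f).restrictScalars k).comp (toPolynomial (k := k) (n := n)) =
      MvPolynomial.aeval
        (Fin.snoc (α := fun _ => MvPowerSeries (Fin n) k) (fun i => MvPowerSeries.X i) f) := by
    refine MvPolynomial.algHom_ext fun i => ?_
    refine Fin.lastCases ?_ (fun i => ?_) i <;> simp [toPolynomial]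
  have h' := DFunLike.congr_fun h A
  simpa [evalAt, coe_aeval_eq_eval] using h'

theorem toPolynomial_monomial (e : Fin (n + 1) →₀ ℕ) (c : k) :
    toPolynomial (MvPolynomial.monomial e c) =
      C (MvPowerSeries.monomial (Finsupp.equivFunOnFinite.symm fun i : Fin n => e i.castSucc) c) *
        X ^ e (Fin.last n) := by
  rw [toPolynomial, MvPolynomial.aeval_monomial, Finsupp.prod_fintype _ _ (by simp),
    Fin.prod_univ_castSucc]
  simp only [Fin.snoc_castSucc, Fin.snoc_last, ← mul_assoc, ← C_pow]
  rw [← map_prod, MvPowerSeries.monomial_eq', Finsupp.prod_fintype _ _ (by simp), map_mul]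
  rfl

theorem coeff_toPolynomial (A : MvPolynomial (Fin (n + 1)) k) (d : Fin n →₀ ℕ) (j : ℕ) :
    MvPowerSeries.coeff d ((toPolynomial A).coeff j) =
      A.coeff (Finsupp.equivFunOnFinite.symm (Fin.snoc (α := fun _ => ℕ) d j)) := by
  classical
  induction A using MvPolynomial.induction_on' with
  | add A B hA hB => simp [hA, hB]
  | monomial e c =>
    rw [toPolynomial_monomial, coeff_C_mul, coeff_X_pow, mul_ite, mul_one, mul_zero,
      MvPolynomial.coeff_monomial]
    have key : e = Finsupp.equivFunOnFinite.symm (Fin.snoc (α := fun _ => ℕ) d j) ↔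
        j = e (Fin.last n) ∧
          d = Finsupp.equivFunOnFinite.symm fun i : Fin n => e i.castSucc := by
      constructor
      · rintro rfl
        refine ⟨by simp, Finsupp.ext fun i => by simp⟩
      · rintro ⟨rfl, rfl⟩
        ext i
        refine Fin.lastCases ?_ (fun i => ?_) i <;> simp
    simp only [key]
    by_cases hj : j = e (Fin.last n)
    · simp [hj, MvPowerSeries.coeff_monomial]
    · simp [hj]

theorem toPolynomial_ne_zero {A : MvPolynomial (Fin (n + 1)) k} (hA : A ≠ 0) :
    toPolynomial A ≠ 0 := by
  obtain ⟨e, he⟩ := MvPolynomial.ne_zero_iff.1 hA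
  intro h0
  apply he
  have h := coeff_toPolynomial A (Finsupp.equivFunOnFinite.symm fun i : Fin n => e i.castSucc)
    (e (Fin.last n))
  rw [h0] at h
  simp only [Polynomial.coeff_zero, map_zero] at h
  rw [h]
  congr 1
  ext i
  refine Fin.lastCases ?_ (fun i => ?_) i <;> simp

theorem toPolynomial_mem_supportedIn (A : MvPolynomial (Fin (n + 1)) k) :
    toPolynomial A ∈ supportedIn k (newtonPolytope A) := by
  intro d j h
  rw [coeff_toPolynomial] at h
  exact subset_convexHull ℝ _ ⟨_, h, rfl⟩

theorem finite_newtonPolytope_generators (A : MvPolynomial (Fin (n + 1)) k) :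
    {x : Fin (n + 1) → ℝ | ∃ e : Fin (n + 1) →₀ ℕ, A.coeff e ≠ 0 ∧ natVec e = x}.Finite := by
  refine (A.support.finite_toSet.image fun e : Fin (n + 1) →₀ ℕ => natVec e).subset ?_
  rintro x ⟨e, he, rfl⟩
  exact ⟨e, by simpa using he, rfl⟩

theorem finite_inter_range_natVec {m : ℕ} {K : Set (Fin m → ℝ)} (hK : Bornology.IsBounded K) :
    (K ∩ Set.range natVec).Finite := by
  obtain ⟨M, hM⟩ := hK.exists_norm_le
  refine ((Set.finite_Iic fun _ : Fin m => ⌊M⌋₊).image natVec).subset ?_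
  rintro _ ⟨hx, v, rfl⟩
  refine ⟨v, fun i => Nat.le_floor ?_, rfl⟩
  exact (le_abs_self _).trans ((norm_le_pi_norm (natVec v) i).trans (hM _ hx))

theorem finite_thickenedPolytope_inter (A : MvPolynomial (Fin (n + 1)) k) :
    (thickenedPolytope A ∩ Set.range natVec).Finite := by
  refine finite_inter_range_natVec (Bornology.IsBounded.add ?_ ?_)
  · exact isBounded_convexHull.2 (finite_newtonPolytope_generators A).isBounded
  · exact Bornology.IsBounded.pi fun _ => Metric.isBounded_Ioc _ _

end Support

/-! ### Congruences modulo powers of `y - f`. -/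

theorem dvd_of_X_sub_C_dvd {R : Type*} [CommRing R] {f : R} {m : ℕ} (hm : 0 < m) {P Q Q' : R[X]}
    (h₁ : (X - C f) ^ m ∣ P - (X - C f) ^ (m - 1) * Q) (h₂ : (X - C f) ∣ Q - Q') :
    (X - C f) ^ m ∣ P - (X - C f) ^ (m - 1) * Q' := by
  have h₃ := mul_dvd_mul_left ((X - C f) ^ (m - 1)) h₂
  rw [← pow_succ, Nat.sub_add_cancel hm] at h₃
  convert dvd_add h₁ h₃ using 1
  ring

theorem X_sub_C_dvd_sub {R : Type*} [CommRing R] {f : R} {Q Q' : R[X]}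
    (h : Q.eval f = Q'.eval f) : (X - C f) ∣ Q - Q' :=
  dvd_iff_isRoot.2 (by simp [h])

/-- The principal part of `P/A = P A^(q-1) / A^q`, with `A = L^m H`, read over the denominator
`A^q`. -/
theorem dvd_mul_pow_sub {R : Type*} [CommRing R] {L P U H : R[X]} {m q : ℕ} (hm : 0 < m)
    (hq : 0 < q) (h : L ^ m ∣ P - L ^ (m - 1) * U) :
    L ^ (m * q) ∣ P * (L ^ m * H) ^ (q - 1) - L ^ (m * q - 1) * (U * H ^ (q - 1)) := by
  obtain ⟨V, hV⟩ := h
  obtain ⟨q, rfl⟩ : ∃ q', q = q' + 1 := ⟨q - 1, by omega⟩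
  obtain ⟨m, rfl⟩ : ∃ m', m = m' + 1 := ⟨m - 1, by omega⟩
  refine ⟨V * H ^ q, ?_⟩
  have e1 : (m + 1) * (q + 1) - 1 = m + (m + 1) * q := by
    have : (m + 1) * (q + 1) = m + (m + 1) * q + 1 := by ring
    omega
  rw [e1]
  simp only [Nat.add_sub_cancel] at hV ⊢
  rw [eq_add_of_sub_eq hV]
  ring

theorem convex_setOf_smul_add_mem {m : ℕ} {K : Set (Fin m → ℝ)} (hK : Convex ℝ K) (c : ℝ)
    (v : Fin m → ℝ) : Convex ℝ {x | c • x + v ∈ K} := by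
  intro x hx y hy a b ha hb hab
  have h := hK hx hy ha hb hab
  rw [Set.mem_ofPred_eq]
  convert h using 1
  ext i
  simp only [Pi.add_apply, Pi.smul_apply, smul_eq_mul]
  linear_combination (-v i) * hab

/-! ### Residues: `f` as a residue, and stability under sections. -/

section Residue

variable {k : Type*} [Field k] {p : ℕ} [Fact p.Prime] [CharP k p] [PerfectRing k p] {n : ℕ}

theorem sum_monomial_mul_eval_polySection_pow (p : ℕ) [Fact p.Prime] [CharP k p] [PerfectRing k p]
    (f : MvPowerSeries (Fin n) k) (H : (MvPowerSeries (Fin n) k)[X]) :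
    ∑ r : Fin n → Fin p, ∑ s ∈ Finset.range p, MvPowerSeries.monomial (residueExponent r) 1 *
      f ^ s * (polySection p (sectionHom r) s H).eval f ^ p = H.eval f := by
  conv_rhs => rw [← sum_C_mul_X_pow_mul_polySection_pow (p := p)
    (fun r : Fin n → Fin p => sectionHom (k := k) r)
    (fun r => MvPowerSeries.monomial (residueExponent r) 1) sum_monomial_mul_sectionHom_pow H]
  simp only [eval_finsetSum, eval_mul, eval_C, eval_pow, eval_X]

/-- If `A = (y - f)ᵐ H`, then `f H(f)` is the leading coefficient at `y = f`, in order `m - 1`,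
of some polynomial supported in the same convex set as `A`. For `m` prime to `p` this is
`m⁻¹ y ∂A/∂y`. -/
theorem exists_supportedIn_dvd_sub (p : ℕ) [Fact p.Prime] [CharP k p] [PerfectRing k p]
    (f : MvPowerSeries (Fin n) k) (m : ℕ) :
    0 < m → ∀ (K : Set (Fin (n + 1) → ℝ)), Convex ℝ K → ∀ H : (MvPowerSeries (Fin n) k)[X],
      (X - C f) ^ m * H ∈ supportedIn k K →
      ∃ P ∈ supportedIn k K,
        (X - C f) ^ m ∣ P - (X - C f) ^ (m - 1) * C (f * H.eval f) := by
  have hp : 0 < p := (Fact.out : p.Prime).pos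
  induction m using Nat.strong_induction_on with
  | _ m ih =>
  intro hm K hK H hA
  -- If `p ∣ m` the logarithmic derivative has zero residue; the sections of `A`, with the smaller
  -- exponent `m'`, replace it. They may have `H`-parts vanishing at `f`, so the induction does not
  -- assume `H(f) ≠ 0`.
  by_cases hpm : p ∣ m
  · obtain ⟨m', rfl⟩ := hpm
    have hm' : 0 < m' := Nat.pos_of_mul_pos_left hm
    have hB : ∀ (r : Fin n → Fin p) (s : ℕ), s < p →
        polySection p (sectionHom r) s ((X - C f) ^ (p * m') * H) =
          (X - C f) ^ m' * polySection p (sectionHom r) s H := by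
      intro r s hs
      rw [mul_comm p m', pow_mul, polySection_pow_mul _ (sectionHom_pow_mul r) hs]
    have hex : ∀ (r : Fin n → Fin p) (s : ℕ), ∃ P, s < p →
        P ∈ supportedIn k {x | (p : ℝ) • x + exponentVec (residueExponent r) s ∈ K} ∧
        (X - C f) ^ m' ∣ P - (X - C f) ^ (m' - 1) *
          C (f * (polySection p (sectionHom r) s H).eval f) := by
      intro r s
      by_cases hs : s < p
      · obtain ⟨P, hP, hd⟩ := ih m' (by nlinarith [(Fact.out : p.Prime).two_le]) hm' _
          (convex_setOf_smul_add_mem hK p (exponentVec (residueExponent r) s)) _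
          (hB r s hs ▸ polySection_mem_supportedIn hA r s)
        exact ⟨P, fun _ => ⟨hP, hd⟩⟩
      · exact ⟨0, fun h => absurd h hs⟩
    choose P hP using hex
    let M : (Fin n → Fin p) → ℕ → (MvPowerSeries (Fin n) k)[X] := fun r s =>
      C (MvPowerSeries.monomial (residueExponent r) 1) * X ^ s
    let B : (Fin n → Fin p) → ℕ → (MvPowerSeries (Fin n) k)[X] := fun r s =>
      polySection p (sectionHom r) s H
    -- Each `p`-th power in the decomposition of `A` has one of its `p` factors replaced by `P r s`.
    refine ⟨∑ r, ∑ s ∈ Finset.range p, M r s * (P r s * ((X - C f) ^ m' * B r s) ^ (p - 1)),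
      Submodule.sum_mem _ fun r _ => Submodule.sum_mem _ fun s hs => ?_, ?_⟩
    · have hs := Finset.mem_range.1 hs
      have h1 := mul_pow_mem_supportedIn (B := {0})
        (convex_setOf_smul_add_mem hK p (exponentVec (residueExponent r) s))
        (by simpa using (hP r s hs).1) (hB r s hs ▸ polySection_mem_supportedIn hA r s) (p - 1)
      refine supportedIn_mono ?_
        (mul_mem_supportedIn (C_monomial_mul_X_pow_mem_supportedIn (residueExponent r) s 1) h1)
      rw [Nat.sub_add_cancel hp]
      rintro _ ⟨_, rfl, _, ⟨_, ⟨x, hx, rfl⟩, _, rfl, rfl⟩, rfl⟩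
      simpa [add_comm] using hx
    · refine dvd_of_X_sub_C_dvd (Q := ∑ r, ∑ s ∈ Finset.range p,
        M r s * (C (f * (B r s).eval f) * B r s ^ (p - 1))) hm ?_ (X_sub_C_dvd_sub ?_)
      · simp only [Finset.mul_sum, ← Finset.sum_sub_distrib]
        refine Finset.dvd_sum fun r _ => Finset.dvd_sum fun s hs => ?_
        have h := dvd_mul_pow_sub (H := B r s) hm' hp (hP r s (Finset.mem_range.1 hs)).2
        rw [mul_comm p m']
        convert h.mul_left (M r s) using 1
        ring
      · have h := sum_monomial_mul_eval_polySection_pow p f H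
        simp only [M, B, eval_finsetSum, eval_mul, eval_C, eval_pow, eval_X]
        conv_rhs => rw [← h]
        simp only [Finset.mul_sum]
        refine Finset.sum_congr rfl fun r _ => Finset.sum_congr rfl fun s _ => ?_
        conv_rhs => rw [← mul_pow_sub_one hp.ne']
        ring
  · have hmk : (m : k) ≠ 0 := fun h => hpm ((CharP.cast_eq_zero_iff k p m).1 h)
    refine ⟨(m : k)⁻¹ • (X * derivative ((X - C f) ^ m * H)),
      Submodule.smul_mem _ _ (X_mul_derivative_mem_supportedIn hA), ?_⟩
    refine dvd_of_X_sub_C_dvd (Q := X * H) hm ?_ (X_sub_C_dvd_sub (by simp))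
    have hc : algebraMap k (MvPowerSeries (Fin n) k)[X] (m : k)⁻¹ * (m : _) = 1 := by
      rw [← map_natCast (algebraMap k (MvPowerSeries (Fin n) k)[X]) m, ← map_mul,
        inv_mul_cancel₀ hmk, map_one]
    refine ⟨algebraMap k (MvPowerSeries (Fin n) k)[X] (m : k)⁻¹ * (X * derivative H), ?_⟩
    rw [derivative_mul, derivative_X_sub_C_pow, Algebra.smul_def]
    simp only [map_natCast]
    linear_combination (X * (X - C f) ^ (m - 1) * H) * hc

theorem dvd_polySection_sub {f g : MvPowerSeries (Fin n) k} {m : ℕ} (hm : 0 < m)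
    {P H : (MvPowerSeries (Fin n) k)[X]}
    (h : (X - C f) ^ m ∣ P - (X - C f) ^ (m - 1) * C (g * H.eval f)) (r : Fin n → Fin p) :
    (X - C f) ^ m ∣
      polySection p (sectionHom r) (p - 1) (P * ((X - C f) ^ m * H) ^ (p - 1)) -
        (X - C f) ^ (m - 1) * C (sectionOp k p r g * H.eval f) := by
  have hp : 0 < p := (Fact.out : p.Prime).pos
  -- Only the value at `f` counts, so `H^(p-1)` becomes a constant and completes `H(f)` to a `p`-th
  -- power.
  have h1 := dvd_of_X_sub_C_dvd (Q' := C (H.eval f ^ p * g)) (Nat.mul_pos hm hp)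
    (dvd_mul_pow_sub (H := H) hm hp h) (X_sub_C_dvd_sub (by
      simp only [eval_mul, eval_C, eval_pow]
      rw [← mul_pow_sub_one hp.ne']
      ring))
  obtain ⟨V, hV⟩ := h1
  have e1 : m * p - 1 = (m - 1) * p + (p - 1) := by
    obtain ⟨m, rfl⟩ : ∃ m', m = m' + 1 := ⟨m - 1, by omega⟩
    have : (m + 1) * p = m * p + p := by ring
    rw [Nat.add_sub_cancel]
    omega
  -- Since `m p - 1 = (m - 1) p + (p - 1)`, the main term is a `p`-th power times `(y - f)^(p-1) g`.
  have e2 : P * ((X - C f) ^ m * H) ^ (p - 1) =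
      ((X - C f) ^ (m - 1) * C (H.eval f)) ^ p * ((X - C f) ^ (p - 1) * C g) +
        ((X - C f) ^ m) ^ p * V := by
    rw [eq_add_of_sub_eq hV, e1, pow_add, pow_mul, C_mul, C_pow]
    ring
  have hs : p - 1 < p := Nat.sub_lt hp one_pos
  rw [e2, polySection_add hp, polySection_pow_mul _ (sectionHom_pow_mul r) hs,
    polySection_pow_mul _ (sectionHom_pow_mul r) hs, polySection_X_sub_C_pow_mul_C]
  refine ⟨polySection p (sectionHom r) (p - 1) V, ?_⟩
  change (X - C f) ^ (m - 1) * C (eval f H) * C (sectionOp k p r g) + _ - _ = _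
  rw [C_mul]
  ring

theorem polySection_mul_pow_mem_supportedIn {K : Set (Fin (n + 1) → ℝ)} (hK : Convex ℝ K)
    {P A : (MvPowerSeries (Fin n) k)[X]}
    (hP : P ∈ supportedIn k (K + Set.univ.pi fun _ => Set.Ioc (-1 : ℝ) 0))
    (hA : A ∈ supportedIn k K) (r : Fin n → Fin p) :
    polySection p (sectionHom r) (p - 1) (P * A ^ (p - 1)) ∈
      supportedIn k (K + Set.univ.pi fun _ => Set.Ioc (-1 : ℝ) 0) := by
  have hp : 0 < p := (Fact.out : p.Prime).pos
  have hp' : (0 : ℝ) < p := Nat.cast_pos.2 hp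
  have h1 := mul_pow_mem_supportedIn hK hP hA (p - 1)
  rw [Nat.sub_add_cancel hp] at h1
  refine supportedIn_mono ?_ (polySection_mem_supportedIn h1 r (p - 1))
  rintro x ⟨_, ⟨y, hy, rfl⟩, b, hb, hx⟩
  -- Here `p (x - y) = b - v` with `b ∈ (-1, 0]` and `v ∈ [0, p - 1]` coordinatewise, so `x - y ∈
  -- (-1, 0]`.
  refine ⟨y, hy, x - y, fun i _ => ?_, by simp⟩
  have hi := congrFun hx i
  have hbi := hb i trivial
  have hv : 0 ≤ exponentVec (residueExponent r) (p - 1) i ∧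
      exponentVec (residueExponent r) (p - 1) i ≤ p - 1 := by
    refine Fin.lastCases ?_ (fun i => ?_) i
    · simp [Nat.cast_sub (Nat.one_le_iff_ne_zero.2 hp.ne'), Nat.one_le_cast.2 hp]
    · have : ((r i : ℕ) : ℝ) + 1 ≤ p := by exact_mod_cast (r i).isLt
      simp only [exponentVec_castSucc, residueExponent_apply]
      exact ⟨Nat.cast_nonneg _, by linarith⟩
  simp only [Pi.add_apply, Pi.smul_apply, smul_eq_mul, Set.mem_Ioc, Pi.sub_apply] at hi hbi ⊢
  constructor
  · refine lt_of_mul_lt_mul_left ?_ hp'.le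
    linarith
  · refine le_of_mul_le_mul_left ?_ hp'
    linarith

end Residue

/-! ### The invariant space and its dimension. -/

section ResidueSpace

variable {k : Type*} [Field k] {n : ℕ}

/-- Multiplication by `(y - f)ᵐ⁻¹ h`, from `k⟦t⟧` to `k⟦t⟧[y] / (y - f)ᵐ`. -/
noncomputable def principalPart (f h : MvPowerSeries (Fin n) k) (m : ℕ) :
    MvPowerSeries (Fin n) k →ₗ[k]
      (MvPowerSeries (Fin n) k)[X] ⧸ Ideal.span {(X - C f : (MvPowerSeries (Fin n) k)[X]) ^ m} :=
  (Ideal.Quotient.mkₐ k _).toLinearMap ∘ₗ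
    LinearMap.mulLeft k ((X - C f) ^ (m - 1) * C h) ∘ₗ
      (CAlgHom (R := k) (A := MvPowerSeries (Fin n) k)).toLinearMap

/-- Cancel `(y - f)^(m-1)` and evaluate at `f`: `h g = 0` in a domain. -/
theorem principalPart_injective {f h : MvPowerSeries (Fin n) k} (hh : h ≠ 0) {m : ℕ}
    (hm : 0 < m) : Function.Injective (principalPart f h m) := by
  rw [injective_iff_map_eq_zero]
  intro g hg
  have h1 : (X - C f) ^ m ∣ (X - C f) ^ (m - 1) * C h * C g :=
    Ideal.mem_span_singleton.1 (Ideal.Quotient.eq_zero_iff_mem.1 hg)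
  obtain ⟨m, rfl⟩ : ∃ m', m = m' + 1 := ⟨m - 1, by omega⟩
  rw [Nat.add_sub_cancel, pow_succ, mul_assoc] at h1
  have h2 := (mul_dvd_mul_iff_left (pow_ne_zero m (X_sub_C_ne_zero f))).1 h1
  rw [dvd_iff_isRoot] at h2
  simpa [hh] using h2

/-- The power series `g` such that `(y - f)ᵐ⁻¹ h g` is congruent modulo `(y - f)ᵐ` to a polynomial
supported in `K`. When `A = (y - f)ᵐ H` with `h = H(f)`, and `m = 1`, these are the residues at
`y = f` of the forms `P / A dy` with `P` supported in `K`. -/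
noncomputable def residueSpace (f h : MvPowerSeries (Fin n) k) (m : ℕ)
    (K : Set (Fin (n + 1) → ℝ)) : Submodule k (MvPowerSeries (Fin n) k) :=
  ((supportedIn k K).map (Ideal.Quotient.mkₐ k _).toLinearMap).comap (principalPart f h m)

theorem mem_residueSpace {f h : MvPowerSeries (Fin n) k} {m : ℕ} {K : Set (Fin (n + 1) → ℝ)}
    {g : MvPowerSeries (Fin n) k} :
    g ∈ residueSpace f h m K ↔
      ∃ P ∈ supportedIn k K, (X - C f) ^ m ∣ P - (X - C f) ^ (m - 1) * C (g * h) := by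
  refine exists_congr fun P => and_congr_right fun _ => ?_
  rw [mul_comm g h, C_mul, ← mul_assoc, ← Ideal.mem_span_singleton]
  exact Ideal.Quotient.eq

theorem finite_and_finrank_residueSpace_le {f h : MvPowerSeries (Fin n) k} (hh : h ≠ 0) {m : ℕ}
    (hm : 0 < m) {K : Set (Fin (n + 1) → ℝ)} (hK : (K ∩ Set.range natVec).Finite) :
    Module.Finite k (residueSpace f h m K) ∧
      Module.finrank k (residueSpace f h m K) ≤ (K ∩ Set.range natVec).ncard := by
  obtain ⟨hfin, hle⟩ := finite_and_finrank_supportedIn_le (k := k) hK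
  let Φ : residueSpace f h m K →ₗ[k] (supportedIn k K).map (Ideal.Quotient.mkₐ k
      (Ideal.span {(X - C f : (MvPowerSeries (Fin n) k)[X]) ^ m})).toLinearMap :=
    (principalPart f h m).restrict fun _ hg => hg
  have hΦ : Function.Injective Φ := fun a b hab =>
    Subtype.ext (principalPart_injective hh hm (congrArg Subtype.val hab))
  exact ⟨Module.Finite.of_injective Φ hΦ, (LinearMap.finrank_le_finrank_of_injective hΦ).trans
    ((Submodule.finrank_map_le _ _).trans hle)⟩

end ResidueSpace

end SectionChristol

theorem theorem2p3 (k : Type*) [Field k] (p : ℕ) [Fact p.Prime] [CharP k p] [PerfectField k]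
    (n : ℕ) (A : MvPolynomial (Fin (n + 1)) k) (hA : A ≠ 0) (f : MvPowerSeries (Fin n) k)
    (hf : SectionChristol.evalAt A f = 0) :
    ∃ W : Submodule k (MvPowerSeries (Fin n) k),
      f ∈ W ∧
      (∀ s ∈ SectionChristol.sectionMonoid k p n, ∀ g ∈ W, s g ∈ W) ∧
      (SectionChristol.thickenedPolytope A ∩ Set.range SectionChristol.natVec).Finite ∧
      Module.Finite k W ∧
      Module.finrank k W ≤
        (SectionChristol.thickenedPolytope A ∩ Set.range SectionChristol.natVec).ncard := by
  open SectionChristol Polynomial in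
  have hA' : toPolynomial A ≠ 0 := toPolynomial_ne_zero hA
  -- Removing the full multiplicity of the root `f` makes `H(f) ≠ 0`, as the dimension bound
  -- requires.
  obtain ⟨H, hH, hdvd⟩ := exists_eq_pow_rootMultiplicity_mul_and_not_dvd _ hA' f
  have hm : 0 < (toPolynomial A).rootMultiplicity f :=
    (rootMultiplicity_pos hA').2 (by rw [IsRoot, eval_toPolynomial, hf])
  have hh : H.eval f ≠ 0 := fun h => hdvd (dvd_iff_isRoot.2 h)
  have hconv : Convex ℝ (newtonPolytope A) := convex_convexHull ℝ _
  have hsupp := toPolynomial_mem_supportedIn A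
  rw [hH] at hsupp
  have hfin := finite_thickenedPolytope_inter A
  refine ⟨residueSpace f (H.eval f) ((toPolynomial A).rootMultiplicity f) (thickenedPolytope A),
    ?_, ?_, hfin, finite_and_finrank_residueSpace_le hh hm hfin⟩
  · obtain ⟨P, hP, hd⟩ := exists_supportedIn_dvd_sub p f _ hm _ hconv H hsupp
    have hsub : newtonPolytope A ⊆ thickenedPolytope A := fun x hx =>
      ⟨x, hx, 0, by simp, by simp⟩
    exact mem_residueSpace.2 ⟨P, supportedIn_mono hsub hP, hd⟩
  · intro s hs
    induction hs using Submonoid.closure_induction with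
    | mem s hs =>
      obtain ⟨r, rfl⟩ := hs
      intro g hg
      obtain ⟨P, hP, hd⟩ := mem_residueSpace.1 hg
      change sectionOp k p r g ∈ _
      exact mem_residueSpace.2 ⟨_, polySection_mul_pow_mem_supportedIn hconv hP hsupp r,
        dvd_polySection_sub hm hd r⟩
    | one => exact fun g hg => hg
    | mul s t _ _ hs ht => exact fun g hg => hs _ (ht g hg)
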